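/- **Theorem 3.1.** Let $V$ be a Euclidean space with inner product $(\cdot,\cdot)$, let $\Phi\subset V$ be an irreducible, essential, reduced crystallographic root system, and let $\Phi^+$ be the set of positive roots with respect to a simple system $\Delta\subset\Phi$; put $m=|\Phi^+|$. For $\alpha\in\Phi$ and $k\in\mathbb Z$ put $\alpha^\vee=\frac{2\alpha}{(\alpha,\alpha)}$, $s_\alpha(x)=x-(x,\alpha^\vee)\alpha$ and $s_{\alpha,k}(x)=s_\alpha(x)+k\alpha$, and let $W_a=\langle s_{\alpha,k} : \alpha\in\Phi,\ k\in\mathbb Z\rangle\subset\mathrm{Aff}(V)$. Put $H^1_{\alpha,k}=\{x\in V : k<(x,\alpha^\vee)<k+1\}$, $A_e=\bigcap_{\gamma\in\Phi^+}H^1_{\gamma,0}$, and $A_w=w(A_e)$ for $w\in W_a$. For every $w\in W_a$ there is a unique tuple of integers $(k(w,\gamma))_{\gamma\in\Phi^+}$ with $A_w=\bigcap_{\gamma\in\Phi^+}H^1_{\gamma,k(w,\gamma)}$, and the map $$\iota:W_a\to\mathbb R^m=\mathbb R^{\Phi^+},\qquad \iota(w)=(k(w,\gamma))_{\gamma\in\Phi^+},$$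 is injective. There is an injective group homomorphism $F:W_a\to\mathrm{Isom}(\mathbb R^m)$ into the group of affine isometries of the Euclidean space $\mathbb R^m$ (called the $\Phi^+$-representation of $W_a$) such that, for every $w\in W_a$, $$F(w)\circ\iota=\iota\circ L_w,$$ where $L_w:W_a\to W_a$, $x\mapsto wx$, is left multiplication. Moreover, $F$ can be chosen so that for all $\alpha\in\Phi^+$, $p\in\mathbb Z$ and $x\in\mathbb R^m$, $$F(s_{\alpha,p})(x)=L_\alpha x+v_{p,\alpha}.$$ Here $L_\alpha$ is the signed permutation matrix whose entry in row $\delta\in\Phi^+$ and column $\gamma\in\Phi^+$ is $1$ if $s_\alpha(\gamma)=\delta$, $-1$ if $s_\alpha(\gamma)=-\delta$, and $0$ otherwise, and $v_{p,\alpha}\in\mathbb R^m$ is the vector with $\gamma$-coordinate $-p\,(\alpha,s_\alpha(\gamma)^\vee)$ if $s_\alpha(\gamma)\in\Phi^+$ and $-1-p\,(\alpha,s_\alpha(\gamma)^\vee)$ if $s_\alpha(\gamma)\in-\Phi^+$. -/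

import Mathlib

noncomputable section

namespace PhiRep

open scoped RealInnerProductSpace

section Euclidean

variable {V : Type*} [NormedAddCommGroup V] [InnerProductSpace ℝ V]

/-- The vector `α^∨ = 2 α / (α, α)`. -/
def dualVec (α : V) : V := (2 / ⟪α, α⟫) • α

/-- The orthogonal reflection `s_α : x ↦ x - 2 (α, x) / (α, α) α`, as a linear map. -/
def refl (α : V) : V →ₗ[ℝ] V where
  toFun x := x - (2 * ⟪α, x⟫ / ⟪α, α⟫) • α
  map_add' x y := by rw [inner_add_right]; module
  map_smul' c x := by rw [inner_smul_right, RingHom.id_apply]; module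

theorem refl_apply (α x : V) : refl α x = x - (2 * ⟪α, x⟫ / ⟪α, α⟫) • α := rfl

theorem refl_self (α : V) : refl α α = -α := by
  rcases eq_or_ne α 0 with rfl | h
  · simp
  · have : ⟪α, α⟫ ≠ 0 := inner_self_ne_zero.mpr h
    rw [refl_apply, mul_div_assoc, div_self this]
    module

theorem refl_involutive (α : V) : Function.Involutive (refl α) := by
  intro x
  conv_lhs => rw [refl_apply α x, map_sub, map_smul, refl_self, refl_apply]
  module

/-- The affine reflection `s_{α,k} : x ↦ x - (2 (α, x) / (α, α) - k) α`, as an element of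
`Aff(V)`. -/
def affineRefl (α : V) (k : ℤ) : V ≃ᵃ[ℝ] V where
  toEquiv := Function.Involutive.toPerm
    (fun x => x - (2 * ⟪α, x⟫ / ⟪α, α⟫ - (k : ℝ)) • α) (by
      have h : ∀ x : V, x - (2 * ⟪α, x⟫ / ⟪α, α⟫ - (k : ℝ)) • α = refl α x + (k : ℝ) • α := by
        intro x
        rw [refl_apply]
        module
      intro x
      simp only [h]
      rw [map_add, refl_involutive, map_smul, refl_self]
      module)
  linear := LinearEquiv.ofInvolutive (refl α) (refl_involutive α)
  map_vadd' p v := by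
    change (v + p) - (2 * ⟪α, v + p⟫ / ⟪α, α⟫ - (k : ℝ)) • α
      = refl α v + (p - (2 * ⟪α, p⟫ / ⟪α, α⟫ - (k : ℝ)) • α)
    rw [refl_apply, inner_add_right]
    module

/-- The strip `H_{α,k}^m = {x | k < (x, α^∨) < k + m}`. -/
def strip (α : V) (k : ℤ) (m : ℝ) : Set V :=
  {x | (k : ℝ) < ⟪x, dualVec α⟫ ∧ ⟪x, dualVec α⟫ < k + m}

end Euclidean

section RootSystem

variable {I V N : Type*} [NormedAddCommGroup V] [InnerProductSpace ℝ V]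
  [AddCommGroup N] [Module ℝ N]

/-- The affine Weyl group `W_a`: the subgroup of `Aff(V)` generated by all `s_{α,k}`, `α ∈ Φ`,
`k ∈ ℤ`. -/
def affineWeylGroup (P : RootPairing I ℝ V N) : Subgroup (V ≃ᵃ[ℝ] V) :=
  Subgroup.closure {g | ∃ (i : I) (k : ℤ), g = affineRefl (P.root i) k}

/-- The affine reflection `s_{α,k}` as an element of `W_a`. -/
def affineReflMem (P : RootPairing I ℝ V N) (i : I) (k : ℤ) : affineWeylGroup P :=
  ⟨affineRefl (P.root i) k, Subgroup.subset_closure ⟨i, k, rfl⟩⟩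

variable [Finite I] {P : RootPairing I ℝ V N} [P.IsCrystallographic]

/-- (The index set of) the positive roots `Φ⁺` with respect to the simple system `b`. -/
abbrev PosRoot (b : P.Base) : Type _ := {i : I // b.IsPos i}

instance instFintypePosRoot (b : P.Base) : Fintype (PosRoot b) := Fintype.ofFinite _

/-- The space `ℝ^m`, `m = |Φ⁺|`, with coordinates indexed by the positive roots. -/
abbrev PhiSpace (b : P.Base) : Type _ := EuclideanSpace ℝ (PosRoot b)

/-- The set `⋂_{γ ∈ Φ⁺} H_{γ, k_γ}^1` attached to a `Φ⁺`-tuple of integers. -/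
def stripInter (b : P.Base) (k : PosRoot b → ℤ) : Set V :=
  ⋂ γ : PosRoot b, strip (P.root γ) (k γ) 1

/-- The alcove `A_w = w A_e`, where `A_e = ⋂_{γ ∈ Φ⁺} H_{γ,0}^1`. -/
def alcove (b : P.Base) (w : affineWeylGroup P) : Set V :=
  (w : V ≃ᵃ[ℝ] V) '' stripInter b (fun _ => 0)

/-- The `Φ⁺`-tuple of integers `(k(w, γ))_γ`, characterized by `A_w = ⋂_γ H_{γ, k(w, γ)}^1`. -/
def shiCoeff (b : P.Base) (w : affineWeylGroup P) : PosRoot b → ℤ :=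
  Classical.epsilon fun k => alcove b w = stripInter b k

/-- The map `ι : W_a → ℝ^m`, `w ↦ (k(w, γ))_γ`. -/
def iota (b : P.Base) (w : affineWeylGroup P) : PhiSpace b :=
  WithLp.toLp 2 fun γ => (shiCoeff b w γ : ℝ)

open Classical in
/-- The matrix `L_α`: the entry in row `δ` and column `γ` is `1` if `s_α(γ) = δ`, is `-1` if
`s_α(γ) = -δ`, and is `0` otherwise. -/
def Lmat (b : P.Base) (α : PosRoot b) : Matrix (PosRoot b) (PosRoot b) ℝ :=
  Matrix.of fun δ γ =>
    if refl (P.root α) (P.root γ) = P.root δ then 1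
    else if refl (P.root α) (P.root γ) = -P.root δ then -1
    else 0

open Classical in
/-- The vector `v_{p,α}`, with `γ`-coordinate `-p (α, s_α(γ)^∨)` if `s_α(γ) ∈ Φ⁺` and
`-1 - p (α, s_α(γ)^∨)` if `s_α(γ) ∈ Φ⁻`. -/
def vvec (b : P.Base) (p : ℤ) (α : PosRoot b) : PhiSpace b :=
  WithLp.toLp 2 fun γ =>
    if ∃ δ : PosRoot b, refl (P.root α) (P.root γ) = P.root δ then
      -(p : ℝ) * ⟪P.root α, dualVec (refl (P.root α) (P.root γ))⟫
    else
      -1 - (p : ℝ) * ⟪P.root α, dualVec (refl (P.root α) (P.root γ))⟫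

end RootSystem

open Classical in
/-- A signed permutation matrix: a permutation matrix whose non-zero entries are `1` or `-1`. -/
def IsSignedPerm {n : Type*} (M : Matrix n n ℝ) : Prop :=
  ∃ (σ : Equiv.Perm n) (ε : n → ℤˣ), ∀ i j, M i j = if σ j = i then ((ε j : ℤ) : ℝ) else 0

end PhiRep

end

/-! Extend a tuple `y` on Φ⁺ to the odd function f on Φ with f γ = y γ + 1/2. An intersection of
unit strips then reads |⟪p, γ^∨⟫ - f γ| < 1/2 for all roots γ, with no reference to positivity. An
element w of W_a has a linear part w̄ permuting Φ, the numbers ⟪w 0, γ^∨⟫ are integers, and ⟪w x,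
γ^∨⟫ = ⟪x, (w̄⁻¹ γ)^∨⟫ + ⟪w 0, γ^∨⟫. So w carries strip intersections to strip intersections through
f ↦ f ∘ w̄⁻¹ + ⟪w 0, ·^∨⟫. The same formula on real tuples (`phiAct`) defines F: it is an action
(`phiAct_mul`), isometric because permuting the roots preserves sums of squares (`dist_phiAct`), and
compatible with ι (`shiCoeff_mul`).

Since F(w) ι(1) = ι(w), injectivity of F reduces to that of ι, that is, to: w A_e = A_e forces w =
1. Fix a ∈ A_e and let N(w) be the set of reflections whose hyperplanes separate a from w a. It is
finite, obeys N(xy) = N(x) ∆ x N(y) x⁻¹, and if non-empty contains some s with N(s) = {s}, namely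
the reflection in the hyperplane first crossed on a generic path (`exists_simple_inversion`). These
properties give strong exchange, hence N(w) = ∅ only for w = 1 (`eq_one_of_eq_empty`). -/

noncomputable section

namespace PhiRep

open scoped RealInnerProductSpace

/-! ### Inversion sets and strong exchange in an abstract group -/

section ReflectionCocycle

variable {G : Type*} [Group G]

/-- Inversion sets of a group generated by a conjugation-stable set `T` of involutions: every
element `w` has a finite set `N w ⊆ T`, the sets satisfy the cocycle identity
`N (x y) = N x ∆ x N(y) x⁻¹`, and every non-empty `N w` contains some `s` with `N s = {s}`. -/
structure IsInversionCocycle (T : Set G) (N : G → Set G) : Prop where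
  closure_eq : Subgroup.closure T = ⊤
  mul_self : ∀ t ∈ T, t * t = 1
  conj_mem : ∀ t ∈ T, ∀ x : G, x * t * x⁻¹ ∈ T
  subset : ∀ w, N w ⊆ T
  finite : ∀ w, (N w).Finite
  cocycle : ∀ x y, ∀ t ∈ T, t ∈ N (x * y) ↔ Xor (t ∈ N x) (x⁻¹ * t * x ∈ N y)
  self_mem : ∀ t ∈ T, t ∈ N t
  exists_simple : ∀ w, (N w).Nonempty → ∃ s ∈ N w, N s = {s}

namespace IsInversionCocycle

variable {T : Set G} {N : G → Set G} (h : IsInversionCocycle T N)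

include h

theorem inv_eq {t : G} (ht : t ∈ T) : t⁻¹ = t := inv_eq_of_mul_eq_one_left (h.mul_self t ht)

theorem mem_simple_mul {s : G} (hs : s ∈ T) (hNs : N s = {s}) (w : G) {t : G} (ht : t ∈ T) :
    t ∈ N (s * w) ↔ Xor (t = s) (s * t * s ∈ N w) := by
  rw [h.cocycle s w t ht, hNs, Set.mem_singleton_iff, h.inv_eq hs]

theorem conj_simple_mem {s t : G} (hs : s ∈ T) (ht : t ∈ T) : s * t * s ∈ T := by
  have := h.conj_mem t ht s
  rwa [h.inv_eq hs] at this

/-- Induction on |N w|: for s in N w with N s = {s}, the cocycle gives N (s w) = s (N w \ {s}) s,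
which is smaller. -/
theorem subset_closure_simple (w : G) :
    N w ⊆ Subgroup.closure {s | s ∈ T ∧ N s = {s}} := by
  induction hn : (N w).ncard using Nat.strong_induction_on generalizing w with
  | _ n ih =>
    intro t ht
    obtain ⟨s, hsw, hs⟩ := h.exists_simple w ⟨t, ht⟩
    have hsT := h.subset w hsw
    have hss := h.mul_self s hsT
    have hsS : s ∈ Subgroup.closure {s | s ∈ T ∧ N s = {s}} := Subgroup.subset_closure ⟨hsT, hs⟩
    have hsub : N (s * w) ⊆ (fun x => s * x * s) '' (N w \ {s}) := by
      intro r hr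
      have hrT := h.subset _ hr
      rw [h.mem_simple_mul hsT hs w hrT] at hr
      have hrs : r ≠ s := by
        rintro rfl
        rw [hss, one_mul] at hr
        exact (xor_def.mp hr).elim (fun h' => h'.2 hsw) (fun h' => h'.2 rfl)
      refine ⟨s * r * s, ⟨?_, ?_⟩, ?_⟩
      · exact (xor_def.mp hr).elim (fun h' => absurd h'.1 hrs) (fun h' => h'.1)
      · intro h'
        apply hrs
        have h2 : s * (s * r * s) * s = s * s * s := by rw [Set.mem_singleton_iff.mp h']
        simpa [mul_assoc, hss, ← mul_assoc s s] using h2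
      · simp only [mul_assoc, hss, mul_one]
        rw [← mul_assoc, hss, one_mul]
    have hlt : (N (s * w)).ncard < n := by
      calc (N (s * w)).ncard ≤ ((fun x => s * x * s) '' (N w \ {s})).ncard :=
            Set.ncard_le_ncard hsub (((h.finite w).sdiff).image _)
        _ ≤ (N w \ {s}).ncard := Set.ncard_image_le (h.finite w).sdiff
        _ < (N w).ncard := Set.ncard_sdiff_singleton_lt_of_mem hsw (h.finite w)
        _ = n := hn
    rcases eq_or_ne t s with rfl | hts
    · exact hsS
    · have hmem : s * t * s ∈ N (s * w) := by
        rw [h.mem_simple_mul hsT hs w (h.conj_simple_mem hsT (h.subset w ht))]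
        right
        have e : s * (s * t * s) * s = t := by
          simp only [mul_assoc, hss, mul_one]
          rw [← mul_assoc, hss, one_mul]
        refine ⟨by rwa [e], fun h' => hts ?_⟩
        rw [← e, h', hss, one_mul]
      have := ih _ hlt (s * w) rfl hmem
      have e : t = s * (s * t * s) * s := by
        simp only [mul_assoc, hss, mul_one]
        rw [← mul_assoc, hss, one_mul]
      rw [e]
      exact mul_mem (mul_mem hsS this) hsS

theorem exists_list (w : G) : ∃ l : List G, (∀ s ∈ l, s ∈ T ∧ N s = {s}) ∧ l.prod = w := by
  have htop : Subgroup.closure {s | s ∈ T ∧ N s = {s}} = ⊤ := by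
    rw [eq_top_iff, ← h.closure_eq, Subgroup.closure_le]
    exact fun t ht => h.subset_closure_simple t (h.self_mem t ht)
  have hw : w ∈ Subgroup.closure {s | s ∈ T ∧ N s = {s}} := htop ▸ Subgroup.mem_top w
  induction hw using Subgroup.closure_induction with
  | mem s hs => exact ⟨[s], by simpa using hs, by simp⟩
  | one => exact ⟨[], by simp, rfl⟩
  | mul x y _ _ hx hy =>
    obtain ⟨l, hl, rfl⟩ := hx
    obtain ⟨l', hl', rfl⟩ := hy
    refine ⟨l ++ l', fun s hs => ?_, List.prod_append⟩
    exact (List.mem_append.mp hs).elim (hl s) (hl' s)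
  | inv x _ hx =>
    obtain ⟨l, hl, rfl⟩ := hx
    refine ⟨l.reverse, fun s hs => hl s (List.mem_reverse.mp hs), ?_⟩
    rw [List.prod_inv_reverse, List.map_congr_left (f := fun x => x⁻¹) (g := id)
      fun s hs => h.inv_eq (hl s hs).1, List.map_id]

/-- By the cocycle, an inversion t of s w is either s, and the first letter is deleted, or s t s is
an inversion of w, and a later letter is deleted. -/
theorem strong_exchange (l : List G) (hl : ∀ s ∈ l, s ∈ T ∧ N s = {s}) (t : G)
    (ht : t ∈ N l.prod) :
    ∃ l' : List G, l'.length + 1 = l.length ∧ (∀ s ∈ l', s ∈ T ∧ N s = {s}) ∧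
      l'.prod = t * l.prod := by
  induction l generalizing t with
  | nil =>
    exfalso
    have htT := h.subset _ ht
    -- The cocycle at 1 * 1 reads p ↔ Xor p p, so N 1 is empty.
    have := (h.cocycle 1 1 t htT)
    simp only [List.prod_nil] at ht
    simp [ht] at this
  | cons s l ih =>
    obtain ⟨hsT, hs⟩ := hl s List.mem_cons_self
    have hss := h.mul_self s hsT
    have hl' : ∀ s ∈ l, s ∈ T ∧ N s = {s} := fun r hr => hl r (List.mem_cons_of_mem _ hr)
    rw [List.prod_cons, h.mem_simple_mul hsT hs _ (h.subset _ ht)] at ht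
    rcases xor_def.mp ht with ⟨rfl, -⟩ | ⟨h1, -⟩
    · exact ⟨l, rfl, hl', by rw [List.prod_cons, ← mul_assoc, hss, one_mul]⟩
    · obtain ⟨l', hlen, hl'', hprod⟩ := ih hl' _ h1
      refine ⟨s :: l', by simp [hlen], ?_, ?_⟩
      · intro r hr
        rcases List.mem_cons.mp hr with rfl | hr
        · exact ⟨hsT, hs⟩
        · exact hl'' r hr
      · rw [List.prod_cons, hprod, List.prod_cons]
        simp only [← mul_assoc, hss, one_mul]

/-- If s l is a word for w, then s ∉ N w forces s ∈ N l; exchange rewrites s l as a word two letters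
shorter. -/
theorem eq_one_of_eq_empty (w : G) (hw : N w = ∅) : w = 1 := by
  obtain ⟨l, hl, rfl⟩ := h.exists_list w
  induction hn : l.length using Nat.strong_induction_on generalizing l with
  | _ n ih =>
    cases l with
    | nil => rfl
    | cons s l =>
      obtain ⟨hsT, hs⟩ := hl s List.mem_cons_self
      have hss := h.mul_self s hsT
      have hl' : ∀ s ∈ l, s ∈ T ∧ N s = {s} := fun r hr => hl r (List.mem_cons_of_mem _ hr)
      have hmem : s ∈ N l.prod := by
        have := h.mem_simple_mul hsT hs l.prod hsT
        rw [← List.prod_cons, hw, hss, one_mul] at this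
        by_contra h'
        simp [h', xor_def] at this
      obtain ⟨l', hlen, hl'', hprod⟩ := h.strong_exchange l hl' s hmem
      rw [List.prod_cons, ← hprod]
      refine ih l'.length ?_ l' hl'' ?_ rfl
      · simp only [List.length_cons] at hn
        lia
      · rw [hprod, ← List.prod_cons, hw]

end IsInversionCocycle

end ReflectionCocycle

/-! ### Affine reflections and affine isometries -/

section AffineReflection

variable {V : Type*} [NormedAddCommGroup V] [InnerProductSpace ℝ V]

theorem inner_dualVec (x α : V) : ⟪x, dualVec α⟫ = 2 * ⟪α, x⟫ / ⟪α, α⟫ := by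
  rw [dualVec, inner_smul_right, real_inner_comm α x]
  ring

theorem inner_dualVec_neg (x α : V) : ⟪x, dualVec (-α)⟫ = -⟪x, dualVec α⟫ := by
  simp only [inner_dualVec, inner_neg_left, inner_neg_right]
  ring

theorem inner_self_dualVec {α : V} (hα : α ≠ 0) : ⟪α, dualVec α⟫ = 2 := by
  have : ⟪α, α⟫ ≠ 0 := inner_self_ne_zero.mpr hα
  rw [inner_dualVec, mul_div_assoc, div_self this, mul_one]

theorem dualVec_dualVec (α : V) : dualVec (dualVec α) = α := by
  rcases eq_or_ne α 0 with rfl | h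
  · simp [dualVec]
  · have : ⟪α, α⟫ ≠ 0 := inner_self_ne_zero.mpr h
    simp only [dualVec, inner_smul_left, inner_smul_right, smul_smul, RCLike.conj_to_real]
    convert one_smul ℝ α using 2
    field_simp

theorem dualVec_smul (c : ℝ) (α : V) : dualVec (c • α) = c⁻¹ • dualVec α := by
  rcases eq_or_ne c 0 with rfl | hc
  · simp [dualVec]
  · simp only [dualVec, inner_smul_left, inner_smul_right, smul_smul, RCLike.conj_to_real]
    congr 1
    field_simp

theorem inner_dualVec_map {f : V →ₗ[ℝ] V} (hf : ∀ x y, ⟪f x, f y⟫ = ⟪x, y⟫) (x α : V) :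
    ⟪f x, dualVec (f α)⟫ = ⟪x, dualVec α⟫ := by
  simp only [inner_dualVec, hf]

theorem refl_apply' (α x : V) : refl α x = x - ⟪x, dualVec α⟫ • α := by
  rw [refl_apply, inner_dualVec]

theorem inner_refl_refl (α x y : V) : ⟪refl α x, refl α y⟫ = ⟪x, y⟫ := by
  rcases eq_or_ne α 0 with rfl | h
  · simp [refl_apply]
  · have : ⟪α, α⟫ ≠ 0 := inner_self_ne_zero.mpr h
    simp only [refl_apply, inner_sub_left, inner_sub_right, inner_smul_left, inner_smul_right,
      RCLike.conj_to_real, real_inner_comm α x]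
    field_simp
    ring

theorem affineRefl_apply (α : V) (k : ℤ) (x : V) :
    affineRefl α k x = x - (⟪x, dualVec α⟫ - k) • α := by
  rw [inner_dualVec]
  rfl

theorem affineRefl_linear (α : V) (k : ℤ) (x : V) : (affineRefl α k).linear x = refl α x := rfl

theorem affineRefl_mul_self (α : V) (k : ℤ) : affineRefl α k * affineRefl α k = 1 := by
  ext x
  exact (affineRefl α k).toEquiv.symm_apply_apply x

theorem affineRefl_inv (α : V) (k : ℤ) : (affineRefl α k)⁻¹ = affineRefl α k :=
  inv_eq_of_mul_eq_one_left (affineRefl_mul_self α k)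

theorem affineEquiv_apply_eq (w : V ≃ᵃ[ℝ] V) (x : V) : w x = w.linear x + w 0 := by
  simpa using w.map_vadd 0 x

theorem affineEquiv_sub (w : V ≃ᵃ[ℝ] V) (x y : V) : w x - w y = w.linear (x - y) := by
  rw [affineEquiv_apply_eq w x, affineEquiv_apply_eq w y, map_sub]
  abel

theorem inner_apply_dualVec {w : V ≃ᵃ[ℝ] V} (hw : ∀ x y, ⟪w.linear x, w.linear y⟫ = ⟪x, y⟫)
    (x α : V) :
    ⟪w x, dualVec (w.linear α)⟫ = ⟪x, dualVec α⟫ + ⟪w 0, dualVec (w.linear α)⟫ := by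
  rw [affineEquiv_apply_eq w x, inner_add_left]
  congr 1
  exact inner_dualVec_map (f := w.linear.toLinearMap) hw x α

theorem apply_affineRefl {w : V ≃ᵃ[ℝ] V} (hw : ∀ x y, ⟪w.linear x, w.linear y⟫ = ⟪x, y⟫)
    (α : V) (k n : ℤ) (hn : (n : ℝ) = k + ⟪w 0, dualVec (w.linear α)⟫) (x : V) :
    w (affineRefl α k x) = affineRefl (w.linear α) n (w x) := by
  rw [affineRefl_apply, affineRefl_apply, inner_apply_dualVec hw, hn, sub_eq_iff_eq_add.mp
    (affineEquiv_sub w (x - (⟪x, dualVec α⟫ - k) • α) x)]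
  simp only [sub_sub_cancel_left, map_neg, map_smul]
  module

end AffineReflection

/-! ### The affine Weyl group permutes roots and keeps coroots integral at the origin's orbit -/

section RootSystem

variable {I V N : Type*} [NormedAddCommGroup V] [InnerProductSpace ℝ V]
  [AddCommGroup N] [Module ℝ N]

/-- The reflections of the root pairing are the orthogonal reflections of the ambient space. -/
def IsEuclidean (P : RootPairing I ℝ V N) : Prop :=
  ∀ (i : I) (x : V), P.reflection i x = refl (P.root i) x

variable {P : RootPairing I ℝ V N}

theorem IsEuclidean.pairing_eq (hP : IsEuclidean P) (i j : I) :
    P.pairing j i = ⟪P.root j, dualVec (P.root i)⟫ := by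
  have h := hP i (P.root j)
  rw [RootPairing.reflection_apply_root, refl_apply', sub_right_inj] at h
  exact smul_left_injective ℝ (P.ne_zero i) h

theorem IsEuclidean.exists_int [P.IsCrystallographic] (hP : IsEuclidean P) (i j : I) :
    ∃ n : ℤ, ⟪P.root j, dualVec (P.root i)⟫ = n := by
  obtain ⟨n, hn⟩ := P.exists_value (S := ℤ) j i
  exact ⟨n, by rw [← hP.pairing_eq, ← hn]; rfl⟩

/-- Isometric affine maps that permute the roots and move the origin to a point on which every
coroot is integral. -/
structure PreservesRoots (P : RootPairing I ℝ V N) (w : V ≃ᵃ[ℝ] V) : Prop where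
  inner : ∀ x y, ⟪w.linear x, w.linear y⟫ = ⟪x, y⟫
  root : ∀ i, ∃ j, P.root j = w.linear (P.root i)
  int : ∀ i, ∃ n : ℤ, ⟪w 0, dualVec (P.root i)⟫ = n

theorem PreservesRoots.exists_root_eq [Finite I] {w : V ≃ᵃ[ℝ] V} (h : PreservesRoots P w) (j : I) :
    ∃ i, w.linear (P.root i) = P.root j := by
  choose f hf using h.root
  have hinj : Function.Injective f := fun i j hij => P.root.injective <|
    w.linear.injective <| by rw [← hf, ← hf, hij]
  obtain ⟨i, rfl⟩ := Finite.surjective_of_injective hinj j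
  exact ⟨i, (hf i).symm⟩

theorem preservesRoots [Finite I] [P.IsCrystallographic] (hP : IsEuclidean P) {w : V ≃ᵃ[ℝ] V}
    (hw : w ∈ affineWeylGroup P) : PreservesRoots P w := by
  induction hw using Subgroup.closure_induction with
  | mem x hx =>
    obtain ⟨i, k, rfl⟩ := hx
    refine ⟨fun x y => inner_refl_refl _ x y, fun j => ⟨P.reflectionPerm i j, ?_⟩, fun j => ?_⟩
    · rw [P.root_reflectionPerm, hP, affineRefl_linear]
    · obtain ⟨n, hn⟩ := hP.exists_int j i
      -- The origin goes to k α, and n is the Cartan integer.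
      refine ⟨k * n, ?_⟩
      rw [affineRefl_apply]
      simp [inner_smul_left, hn]
  | one => exact ⟨fun x y => rfl, fun i => ⟨i, rfl⟩, fun i => ⟨0, by simp⟩⟩
  | mul x y _ _ hx hy =>
    refine ⟨fun u v => (hx.inner _ _).trans (hy.inner u v), fun i => ?_, fun i => ?_⟩
    · obtain ⟨j, hj⟩ := hy.root i
      obtain ⟨l, hl⟩ := hx.root j
      exact ⟨l, by rw [hl, hj]; rfl⟩
    · obtain ⟨j, hj⟩ := hx.exists_root_eq i
      obtain ⟨m, hm⟩ := hx.int i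
      obtain ⟨n, hn⟩ := hy.int j
      refine ⟨n + m, ?_⟩
      rw [show (x * y) 0 = x (y 0) from rfl, ← hj, inner_apply_dualVec hx.inner, hj, hn, hm]
      push_cast; rfl
  | inv x _ hx =>
    have hl : ∀ u, x.linear ((x⁻¹).linear u) = u := fun u => x.linear.apply_symm_apply u
    refine ⟨fun u v => ?_, fun i => ?_, fun i => ?_⟩
    · rw [← hx.inner, hl, hl]
    · obtain ⟨j, hj⟩ := hx.exists_root_eq i
      exact ⟨j, x.linear.injective (by rw [hj, hl])⟩
    · obtain ⟨j, hj⟩ := hx.root i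
      obtain ⟨n, hn⟩ := hx.int j
      refine ⟨-n, ?_⟩
      have h1 := inner_apply_dualVec hx.inner ((x⁻¹) 0) (P.root i)
      have h2 : x ((x⁻¹) 0) = 0 := x.apply_symm_apply 0
      rw [h2, inner_zero_left, ← hj, hn] at h1
      push_cast
      linarith

section Perm

variable [Finite I] [P.IsCrystallographic] (hP : IsEuclidean P)

/-- The permutation of the roots induced by an element of the affine Weyl group. -/
def rootIdx (w : affineWeylGroup P) (i : I) : I := ((preservesRoots hP w.2).root i).choose

theorem root_rootIdx (w : affineWeylGroup P) (i : I) :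
    P.root (rootIdx hP w i) = (w : V ≃ᵃ[ℝ] V).linear (P.root i) :=
  ((preservesRoots hP w.2).root i).choose_spec

theorem rootIdx_mul (w w' : affineWeylGroup P) (i : I) :
    rootIdx hP (w * w') i = rootIdx hP w (rootIdx hP w' i) := by
  apply P.root.injective
  simp only [root_rootIdx]
  rfl

theorem rootIdx_one (i : I) : rootIdx hP 1 i = i := by
  apply P.root.injective
  rw [root_rootIdx]
  rfl

theorem rootIdx_inv_rootIdx (w : affineWeylGroup P) (i : I) :
    rootIdx hP w⁻¹ (rootIdx hP w i) = i := by
  rw [← rootIdx_mul, inv_mul_cancel, rootIdx_one]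

theorem rootIdx_rootIdx_inv (w : affineWeylGroup P) (i : I) :
    rootIdx hP w (rootIdx hP w⁻¹ i) = i := by
  rw [← rootIdx_mul, mul_inv_cancel, rootIdx_one]

theorem rootIdx_neg (w : affineWeylGroup P) (i : I) :
    rootIdx hP w (P.reflectionPerm i i) =
      P.reflectionPerm (rootIdx hP w i) (rootIdx hP w i) := by
  apply P.root.injective
  rw [root_rootIdx, P.root_reflectionPerm, P.root_reflectionPerm, P.reflection_apply_self,
    P.reflection_apply_self, root_rootIdx, map_neg]

theorem inner_coe_apply_dualVec (w : affineWeylGroup P) (x : V) (i : I) :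
    ⟪(w : V ≃ᵃ[ℝ] V) x, dualVec (P.root i)⟫ =
      ⟪x, dualVec (P.root (rootIdx hP w⁻¹ i))⟫ + ⟪(w : V ≃ᵃ[ℝ] V) 0, dualVec (P.root i)⟫ := by
  have h := inner_apply_dualVec (preservesRoots hP w.2).inner x (P.root (rootIdx hP w⁻¹ i))
  rwa [← root_rootIdx hP w, rootIdx_rootIdx_inv] at h

end Perm

end RootSystem

/-! ### Strips in terms of odd functions on the roots -/

section OddExtension

variable {I V N : Type*} [NormedAddCommGroup V] [InnerProductSpace ℝ V]
  [AddCommGroup N] [Module ℝ N] {P : RootPairing I ℝ V N}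

theorem isPos_neg_iff (b : P.Base) (i : I) : b.IsPos (P.reflectionPerm i i) ↔ ¬ b.IsPos i :=
  RootPairing.Base.IsPos.neg_iff_not b i

theorem root_reflectionPerm_self (i : I) : P.root (P.reflectionPerm i i) = -P.root i := by
  rw [P.root_reflectionPerm, P.reflection_apply_self]

theorem reflectionPerm_self_self (i : I) :
    P.reflectionPerm (P.reflectionPerm i i) (P.reflectionPerm i i) = i := by
  apply P.root.injective
  rw [root_reflectionPerm_self, root_reflectionPerm_self, neg_neg]

open Classical in
/-- The odd function on the roots with value `y γ + 1 / 2` at every positive root `γ`. -/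
def oddExt (b : P.Base) (y : PosRoot b → ℝ) (i : I) : ℝ :=
  if h : b.IsPos i then y ⟨i, h⟩ + 1 / 2
  else -(y ⟨P.reflectionPerm i i, (isPos_neg_iff b i).mpr h⟩ + 1 / 2)

theorem oddExt_pos (b : P.Base) (y : PosRoot b → ℝ) (γ : PosRoot b) :
    oddExt b y γ = y γ + 1 / 2 := dif_pos γ.2

theorem oddExt_neg (b : P.Base) (y : PosRoot b → ℝ) (i : I) :
    oddExt b y (P.reflectionPerm i i) = -oddExt b y i := by
  by_cases h : b.IsPos i
  · have h' : ¬ b.IsPos (P.reflectionPerm i i) := by rwa [isPos_neg_iff, not_not]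
    rw [oddExt, oddExt, dif_pos h, dif_neg h']
    simp only [reflectionPerm_self_self]
  · rw [oddExt, oddExt, dif_neg h, dif_pos ((isPos_neg_iff b i).mpr h), neg_neg]

theorem forall_of_posRoot (b : P.Base) {p : I → Prop} (hpos : ∀ γ : PosRoot b, p γ)
    (hneg : ∀ i, p i → p (P.reflectionPerm i i)) (i : I) : p i := by
  by_cases h : b.IsPos i
  · exact hpos ⟨i, h⟩
  · have := hneg _ (hpos ⟨_, (isPos_neg_iff b i).mpr h⟩)
    rwa [reflectionPerm_self_self] at this

theorem oddExt_eq_of_posRoot (b : P.Base) {y : PosRoot b → ℝ} {z : I → ℝ}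
    (hz : ∀ i, z (P.reflectionPerm i i) = -z i) (h : ∀ γ : PosRoot b, y γ + 1 / 2 = z γ) (i : I) :
    oddExt b y i = z i := by
  refine forall_of_posRoot b (p := fun i => oddExt b y i = z i) (fun γ => ?_)
    (fun j hj => ?_) i
  · rw [oddExt_pos, h]
  · rw [oddExt_neg, hz, hj]

/-- Measured from the midpoint k + 1/2 of its strip, the condition at γ is the same as the condition
at -γ. -/
theorem mem_stripInter_iff [Finite I] [P.IsCrystallographic] (b : P.Base) (k : PosRoot b → ℤ)
    (p : V) :
    p ∈ stripInter b k ↔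
      ∀ i, |⟪p, dualVec (P.root i)⟫ - oddExt b (fun γ => (k γ : ℝ)) i| < 1 / 2 := by
  have hpos : ∀ γ : PosRoot b, p ∈ strip (P.root γ) (k γ) 1 ↔
      |⟪p, dualVec (P.root γ)⟫ - oddExt b (fun γ => (k γ : ℝ)) γ| < 1 / 2 := by
    intro γ
    rw [oddExt_pos, abs_lt, strip, Set.mem_ofPred_eq]
    constructor <;> rintro ⟨h1, h2⟩ <;> constructor <;> linarith
  rw [stripInter, Set.mem_iInter]
  refine ⟨fun h => forall_of_posRoot b (fun γ => (hpos γ).mp (h γ)) fun i hi => ?_,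
    fun h γ => (hpos γ).mpr (h γ)⟩
  rw [oddExt_neg, root_reflectionPerm_self, inner_dualVec_neg, neg_sub_neg, abs_sub_comm]
  exact hi

end OddExtension

/-! ### The action on tuples and the representation F -/

section Action

variable {I V N : Type*} [Finite I] [NormedAddCommGroup V] [InnerProductSpace ℝ V]
  [AddCommGroup N] [Module ℝ N] {P : RootPairing I ℝ V N} [P.IsCrystallographic]
  (hP : IsEuclidean P) (b : P.Base)

/-- The action of the affine Weyl group on tuples indexed by the positive roots: on odd extensions
it is the permutation of the roots followed by a translation. -/
def phiAct (w : affineWeylGroup P) (y : PosRoot b → ℝ) (γ : PosRoot b) : ℝ :=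
  oddExt b y (rootIdx hP w⁻¹ γ) + ⟪(w : V ≃ᵃ[ℝ] V) 0, dualVec (P.root γ)⟫ - 1 / 2

/-- The right side is odd in the root, hence determined by its values on Φ⁺. This lets actions be
composed on all of Φ. -/
theorem oddExt_phiAct (w : affineWeylGroup P) (y : PosRoot b → ℝ) (i : I) :
    oddExt b (phiAct hP b w y) i =
      oddExt b y (rootIdx hP w⁻¹ i) + ⟪(w : V ≃ᵃ[ℝ] V) 0, dualVec (P.root i)⟫ := by
  refine oddExt_eq_of_posRoot b
    (z := fun i => oddExt b y (rootIdx hP w⁻¹ i) + ⟪(w : V ≃ᵃ[ℝ] V) 0, dualVec (P.root i)⟫)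
    (fun j => ?_) (fun γ => ?_) i
  · simp only [rootIdx_neg, oddExt_neg, root_reflectionPerm_self, inner_dualVec_neg]
    ring
  · simp only [phiAct]
    ring

theorem phiAct_one (y : PosRoot b → ℝ) : phiAct hP b 1 y = y := by
  funext γ
  have h : ((1 : affineWeylGroup P) : V ≃ᵃ[ℝ] V) 0 = 0 := rfl
  rw [phiAct, inv_one, rootIdx_one, oddExt_pos, h, inner_zero_left]
  ring

theorem phiAct_mul (w w' : affineWeylGroup P) (y : PosRoot b → ℝ) :
    phiAct hP b (w * w') y = phiAct hP b w (phiAct hP b w' y) := by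
  funext γ
  have h : ((w * w' : affineWeylGroup P) : V ≃ᵃ[ℝ] V) 0 =
      (w : V ≃ᵃ[ℝ] V) ((w' : V ≃ᵃ[ℝ] V) 0) := rfl
  rw [phiAct, phiAct, oddExt_phiAct, mul_inv_rev, rootIdx_mul, h, inner_coe_apply_dualVec hP w]
  ring

theorem exists_int_eq_phiAct (w : affineWeylGroup P) (k : PosRoot b → ℤ) :
    ∃ k' : PosRoot b → ℤ, (fun γ => (k' γ : ℝ)) = phiAct hP b w (fun γ => (k γ : ℝ)) := by
  have hodd : ∀ i, ∃ n : ℤ, oddExt b (fun γ => (k γ : ℝ)) i = n + 1 / 2 := by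
    -- Half-integers are stable under negation: -(n + 1/2) = (-n - 1) + 1/2.
    refine forall_of_posRoot b (fun γ => ⟨k γ, oddExt_pos b _ γ⟩) fun i ⟨n, hn⟩ => ⟨-n - 1, ?_⟩
    rw [oddExt_neg, hn]
    push_cast
    ring
  have : ∀ γ : PosRoot b, ∃ n : ℤ, (n : ℝ) = phiAct hP b w (fun γ => (k γ : ℝ)) γ := by
    intro γ
    obtain ⟨m, hm⟩ := hodd (rootIdx hP w⁻¹ γ)
    obtain ⟨n, hn⟩ := (preservesRoots hP w.2).int γ
    refine ⟨m + n, ?_⟩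
    rw [phiAct, hm, hn]
    push_cast
    ring
  choose k' hk' using this
  exact ⟨k', funext hk'⟩

theorem image_stripInter (w : affineWeylGroup P) {k k' : PosRoot b → ℤ}
    (hk : (fun γ => (k' γ : ℝ)) = phiAct hP b w (fun γ => (k γ : ℝ))) :
    (w : V ≃ᵃ[ℝ] V) '' stripInter b k = stripInter b k' := by
  have key : ∀ x, (w : V ≃ᵃ[ℝ] V) x ∈ stripInter b k' ↔ x ∈ stripInter b k := by
    intro x
    rw [mem_stripInter_iff, mem_stripInter_iff]
    have e : ∀ i, ⟪(w : V ≃ᵃ[ℝ] V) x, dualVec (P.root i)⟫ - oddExt b (fun γ => (k' γ : ℝ)) i =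
        ⟪x, dualVec (P.root (rootIdx hP w⁻¹ i))⟫ -
          oddExt b (fun γ => (k γ : ℝ)) (rootIdx hP w⁻¹ i) := by
      intro i
      rw [hk, oddExt_phiAct, inner_coe_apply_dualVec hP w]
      ring
    simp only [e]
    refine ⟨fun h i => ?_, fun h i => h _⟩
    have := h (rootIdx hP w i)
    rwa [rootIdx_inv_rootIdx] at this
  ext p
  obtain ⟨x, rfl⟩ := (w : V ≃ᵃ[ℝ] V).surjective p
  rw [key, (w : V ≃ᵃ[ℝ] V).injective.mem_set_image]

include hP in
theorem exists_alcove_eq (w : affineWeylGroup P) : ∃ k, alcove b w = stripInter b k := by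
  obtain ⟨k, hk⟩ := exists_int_eq_phiAct hP b w (fun _ => 0)
  exact ⟨k, image_stripInter hP b w hk⟩

include hP in
theorem alcove_eq_stripInter_shiCoeff (w : affineWeylGroup P) :
    alcove b w = stripInter b (shiCoeff b w) :=
  Classical.epsilon_spec (exists_alcove_eq hP b w)

omit [Finite I] [P.IsCrystallographic] in
-- Simple roots are linearly independent, so some functional is 1 on each; Riesz duality turns it
-- into a vector.
theorem exists_inner_root_eq_height [FiniteDimensional ℝ V] (b : P.Base) :
    ∃ x : V, ∀ i, ⟪x, P.root i⟫ = (b.height i : ℝ) := by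
  obtain ⟨f, hf⟩ := Module.exists_dual_forall_apply_eq_one b.linearIndepOn_root
  refine ⟨(InnerProductSpace.toDual ℝ V).symm (LinearMap.toContinuousLinearMap f), fun i => ?_⟩
  obtain ⟨c, -, -, hc⟩ := b.exists_root_eq_sum_int i
  rw [InnerProductSpace.toDual_symm_apply, b.height_eq_sum hc, hc]
  simp only [LinearMap.coe_toContinuousLinearMap', map_sum, map_zsmul]
  push_cast
  refine Finset.sum_congr rfl fun j hj => ?_
  rw [hf j hj]
  simp

omit [P.IsCrystallographic] in
theorem stripInter_zero_nonempty [FiniteDimensional ℝ V] :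
    (stripInter b (fun _ => 0)).Nonempty := by
  obtain ⟨x, hx⟩ := exists_inner_root_eq_height b
  have hpos : ∀ γ : PosRoot b, 0 < ⟪x, dualVec (P.root γ)⟫ := by
    intro γ
    rw [inner_dualVec, real_inner_comm, hx]
    have h1 : (0 : ℝ) < b.height γ := by exact_mod_cast γ.2
    have h2 : 0 < ⟪P.root γ, P.root γ⟫ := real_inner_self_pos.mpr (P.ne_zero γ)
    positivity
  -- A bound above every coordinate of `x`; dividing by it brings all of them into (0, 1).
  set M : ℝ := 1 + ∑ γ : PosRoot b, ⟪x, dualVec (P.root γ)⟫ with hM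
  have hlt : ∀ γ : PosRoot b, ⟪x, dualVec (P.root γ)⟫ < M := by
    intro γ
    have := Finset.single_le_sum (f := fun γ : PosRoot b => ⟪x, dualVec (P.root γ)⟫)
      (fun δ _ => (hpos δ).le) (Finset.mem_univ γ)
    beta_reduce at this
    linarith
  have hM0 : 0 < M := by
    have := Finset.sum_nonneg fun (γ : PosRoot b) (_ : γ ∈ Finset.univ) => (hpos γ).le
    linarith
  refine ⟨M⁻¹ • x, Set.mem_iInter.mpr fun γ => ?_⟩
  simp only [strip, Set.mem_ofPred_eq, inner_smul_left, RCLike.conj_to_real, Int.cast_zero,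
    zero_add]
  refine ⟨mul_pos (inv_pos.mpr hM0) (hpos γ), ?_⟩
  rw [inv_mul_lt_iff₀ hM0, mul_one]
  exact hlt γ

omit [P.IsCrystallographic] in
theorem alcove_nonempty [FiniteDimensional ℝ V] (w : affineWeylGroup P) :
    (alcove b w).Nonempty := (stripInter_zero_nonempty b).image _

omit [Finite I] [P.IsCrystallographic] in
theorem eq_of_mem_stripInter {k k' : PosRoot b → ℤ} {p : V} (h : p ∈ stripInter b k)
    (h' : p ∈ stripInter b k') : k = k' := by
  funext γ
  obtain ⟨h1, h2⟩ := Set.mem_iInter.mp h γ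
  obtain ⟨h3, h4⟩ := Set.mem_iInter.mp h' γ
  have h5 : k γ < k' γ + 1 := by exact_mod_cast h1.trans h4
  have h6 : k' γ < k γ + 1 := by exact_mod_cast h3.trans h2
  lia

include hP in
-- Strip intersections with different tuples are disjoint, and alcoves are non-empty.
theorem alcove_eq_stripInter_iff [FiniteDimensional ℝ V] (w : affineWeylGroup P)
    (k : PosRoot b → ℤ) : alcove b w = stripInter b k ↔ k = shiCoeff b w := by
  have hs := alcove_eq_stripInter_shiCoeff hP b w
  refine ⟨fun h => ?_, fun h => h ▸ hs⟩
  obtain ⟨p, hp⟩ := alcove_nonempty b w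
  exact eq_of_mem_stripInter b (h ▸ hp) (hs ▸ hp)

theorem shiCoeff_mul [FiniteDimensional ℝ V] (w x : affineWeylGroup P) :
    (fun γ => (shiCoeff b (w * x) γ : ℝ)) =
      phiAct hP b w (fun γ => (shiCoeff b x γ : ℝ)) := by
  obtain ⟨k, hk⟩ := exists_int_eq_phiAct hP b w (shiCoeff b x)
  rw [← hk, ← (alcove_eq_stripInter_iff hP b (w * x) k).mp]
  rw [← image_stripInter hP b w hk, ← alcove_eq_stripInter_shiCoeff hP, alcove, alcove,
    Set.image_image]
  rfl

/-- In a difference of two odd extensions the translation cancels and only a permutation of Φ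
remains; a sum of squares over Φ is twice that over Φ⁺. -/
theorem dist_phiAct (w : affineWeylGroup P) (y z : PosRoot b → ℝ) :
    ∑ γ, (phiAct hP b w y γ - phiAct hP b w z γ) ^ 2 = ∑ γ, (y γ - z γ) ^ 2 := by
  classical
  have := Fintype.ofFinite I
  have key : ∀ f : I → ℝ, (∀ i, f (P.reflectionPerm i i) = -f i) →
      ∑ i, f i ^ 2 = 2 * ∑ γ : PosRoot b, f γ ^ 2 := by
    intro f hf
    have hneg : ∑ i with ¬ b.IsPos i, f i ^ 2 = ∑ i with b.IsPos i, f i ^ 2 := by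
      refine Finset.sum_nbij' (fun i => P.reflectionPerm i i) (fun i => P.reflectionPerm i i)
        ?_ ?_ ?_ ?_ ?_
      · intro i hi
        simpa [isPos_neg_iff] using hi
      · intro i hi
        simpa [isPos_neg_iff] using hi
      · intro i _
        exact reflectionPerm_self_self i
      · intro i _
        exact reflectionPerm_self_self i
      · intro i _
        rw [hf, neg_sq]
    rw [← Finset.sum_filter_add_sum_filter_not Finset.univ b.IsPos, hneg, ← two_mul]
    congr 1
    exact Finset.sum_subtype _ (by simp) _
  have e1 := key (fun i => oddExt b (phiAct hP b w y) i - oddExt b (phiAct hP b w z) i)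
    (fun i => by rw [oddExt_neg, oddExt_neg]; ring)
  have e2 := key (fun i => oddExt b y i - oddExt b z i)
    (fun i => by rw [oddExt_neg, oddExt_neg]; ring)
  simp only [oddExt_pos, add_sub_add_right_eq_sub] at e1 e2
  have e3 : ∑ i, (oddExt b (phiAct hP b w y) i - oddExt b (phiAct hP b w z) i) ^ 2 =
      ∑ i, (oddExt b y i - oddExt b z i) ^ 2 := by
    refine Finset.sum_nbij' (rootIdx hP w⁻¹) (rootIdx hP w) ?_ ?_ ?_ ?_ ?_
    · simp
    · simp
    · intro i _
      exact rootIdx_rootIdx_inv hP w i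
    · intro i _
      exact rootIdx_inv_rootIdx hP w i
    · intro i _
      rw [oddExt_phiAct, oddExt_phiAct, add_sub_add_right_eq_sub]
  linarith

/-- The `Φ⁺`-representation on the level of isometries. -/
def phiIsometry (w : affineWeylGroup P) : PhiSpace b ≃ᵢ PhiSpace b where
  toFun x := WithLp.toLp 2 (phiAct hP b w (WithLp.ofLp x))
  invFun x := WithLp.toLp 2 (phiAct hP b w⁻¹ (WithLp.ofLp x))
  left_inv x := by
    simp only [← phiAct_mul, inv_mul_cancel, phiAct_one]
  right_inv x := by
    simp only [← phiAct_mul, mul_inv_cancel, phiAct_one]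
  isometry_toFun := by
    refine Isometry.of_dist_eq fun x y => ?_
    simp only [EuclideanSpace.dist_eq, Real.dist_eq, sq_abs]
    rw [dist_phiAct]

/-- The `Φ⁺`-representation of the affine Weyl group. -/
def phiRep : affineWeylGroup P →* (PhiSpace b ≃ᵃⁱ[ℝ] PhiSpace b) where
  -- Affineness comes from the Mazur–Ulam theorem.
  toFun w := (phiIsometry hP b w).toRealAffineIsometryEquiv
  map_one' := by
    ext1 x
    simp [phiIsometry, phiAct_one]
  map_mul' w w' := by
    ext1 x
    simp [phiIsometry, phiAct_mul]

theorem phiRep_apply (w : affineWeylGroup P) (x : PhiSpace b) :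
    phiRep hP b w x = WithLp.toLp 2 (phiAct hP b w (WithLp.ofLp x)) := rfl

theorem phiRep_comp_iota [FiniteDimensional ℝ V] (w : affineWeylGroup P) :
    phiRep hP b w ∘ iota b = iota b ∘ fun x => w * x := by
  funext x
  simp only [Function.comp_apply, phiRep_apply, iota, shiCoeff_mul hP]

end Action

/-! ### Separation by hyperplanes -/

section Separation

variable {V : Type*} [NormedAddCommGroup V] [InnerProductSpace ℝ V]

/-- Displacements are multiples of α, so for α ≠ 0 a negative inner product says that the hyperplane
separates x and y. This criterion involves only the reflection as a map, not the choice of (α, k).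
-/
theorem inner_displacement (α : V) (k : ℤ) (x y : V) :
    ⟪affineRefl α k x - x, affineRefl α k y - y⟫ =
      (⟪x, dualVec α⟫ - k) * (⟪y, dualVec α⟫ - k) * ⟪α, α⟫ := by
  simp only [affineRefl_apply, sub_sub_cancel_left, inner_neg_neg, inner_smul_left,
    inner_smul_right, RCLike.conj_to_real]
  ring

theorem inner_displacement_neg_iff {α : V} (hα : α ≠ 0) (k : ℤ) (x y : V) :
    ⟪affineRefl α k x - x, affineRefl α k y - y⟫ < 0 ↔
      (⟪x, dualVec α⟫ - k) * (⟪y, dualVec α⟫ - k) < 0 := by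
  have h : 0 < ⟪α, α⟫ := real_inner_self_pos.mpr hα
  rw [inner_displacement, ← not_le, ← not_le, mul_nonneg_iff_of_pos_right h]

theorem inner_displacement_nonpos_iff {α : V} (hα : α ≠ 0) (k : ℤ) (x y : V) :
    ⟪affineRefl α k x - x, affineRefl α k y - y⟫ ≤ 0 ↔
      (⟪x, dualVec α⟫ - k) * (⟪y, dualVec α⟫ - k) ≤ 0 := by
  have h : 0 < ⟪α, α⟫ := real_inner_self_pos.mpr hα
  rw [inner_displacement, ← not_lt, ← not_lt, mul_pos_iff_of_pos_right h]

theorem inner_displacement_apply_neg {α : V} {k : ℤ} {x : V} (hx : ⟪x, dualVec α⟫ - k ≠ 0)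
    (hα : α ≠ 0) :
    ⟪affineRefl α k x - x, affineRefl α k (affineRefl α k x) - affineRefl α k x⟫ < 0 := by
  have h : ⟪affineRefl α k x, dualVec α⟫ - k = -(⟪x, dualVec α⟫ - k) := by
    rw [affineRefl_apply, inner_sub_left, inner_smul_left, inner_self_dualVec hα,
      RCLike.conj_to_real]
    ring
  rw [inner_displacement_neg_iff hα, h, mul_neg, neg_neg_iff_pos]
  exact mul_self_pos.mpr hx

theorem inner_displacement_conj {w : V ≃ᵃ[ℝ] V}
    (hw : ∀ x y, ⟪w.linear x, w.linear y⟫ = ⟪x, y⟫) (t : V ≃ᵃ[ℝ] V) (x y : V) :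
    ⟪(w * t * w⁻¹) (w x) - w x, (w * t * w⁻¹) (w y) - w y⟫ = ⟪t x - x, t y - y⟫ := by
  have h : ∀ z, (w * t * w⁻¹) (w z) = w (t z) := fun z =>
    congrArg (fun u => w (t u)) (w.symm_apply_apply z)
  rw [h, h, affineEquiv_sub, affineEquiv_sub, hw]

/-- Affine reflections whose hyperplanes are proportional as seen from a point are equal. -/
theorem affineRefl_eq_of_smul_eq {α β : V} {k l : ℤ} {a : V}
    (hα : ⟪a, dualVec α⟫ - k ≠ 0) (hβ : ⟪a, dualVec β⟫ - l ≠ 0)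
    (h : (⟪a, dualVec α⟫ - k) • dualVec β = (⟪a, dualVec β⟫ - l) • dualVec α) :
    affineRefl α k = affineRefl β l := by
  set A := ⟪a, dualVec α⟫ - k with hA
  set B := ⟪a, dualVec β⟫ - l with hB
  have h1 : dualVec β = (A⁻¹ * B) • dualVec α := by
    rw [mul_smul, ← h, smul_smul, inv_mul_cancel₀ hα, one_smul]
  have h2 : β = (B⁻¹ * A) • α := by
    rw [← dualVec_dualVec β, h1, dualVec_smul, dualVec_dualVec, mul_inv, inv_inv, mul_comm]
  have h3 : ∀ x, ⟪x, dualVec β⟫ - l = A⁻¹ * B * (⟪x, dualVec α⟫ - k) := by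
    intro x
    have e1 : ⟪x, dualVec β⟫ = A⁻¹ * B * ⟪x, dualVec α⟫ := by rw [h1, inner_smul_right]
    have e2 : ⟪a, dualVec β⟫ = A⁻¹ * B * ⟪a, dualVec α⟫ := by rw [h1, inner_smul_right]
    have e3 : A⁻¹ * B * A = B := by field_simp
    linear_combination e1 - e2 - e3 - hB + A⁻¹ * B * hA
  ext x
  rw [affineRefl_apply, affineRefl_apply, h3]
  congr 1
  conv_rhs => rw [h2, smul_smul]
  congr 1
  field_simp

theorem dense_inner_ne [FiniteDimensional ℝ V] {u : V} (hu : u ≠ 0) (c : ℝ) :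
    Dense {x : V | ⟪x, u⟫ ≠ c} := by
  have hs : Function.Surjective (innerₛₗ ℝ u) := fun r =>
    ⟨(r / ⟪u, u⟫) • u, by
      rw [innerₛₗ_apply_apply, inner_smul_right, div_mul_cancel₀ _ (inner_self_ne_zero.mpr hu)]⟩
  have hd := (dense_compl_singleton c).preimage
    ((innerₛₗ ℝ u).isOpenMap_of_finiteDimensional hs)
  convert hd using 1
  ext x
  simp [real_inner_comm]

theorem isOpen_inner_ne (u : V) (c : ℝ) : IsOpen {x : V | ⟪x, u⟫ ≠ c} :=
  isOpen_ne_fun (by fun_prop) continuous_const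

/-- Near any point there is a point `x` such that the segment from `a` to `x` meets no two of
finitely many given distinct hyperplanes simultaneously. -/
theorem exists_generic [FiniteDimensional ℝ V] {ι : Type*} {S : Set ι} (hS : S.Finite)
    (α : ι → V) (k : ι → ℤ) (a : V) (ha : ∀ i ∈ S, ⟪a, dualVec (α i)⟫ - k i ≠ 0)
    (hne : ∀ i ∈ S, ∀ j ∈ S, i ≠ j → affineRefl (α i) (k i) ≠ affineRefl (α j) (k j))
    {U : Set V} (hU : IsOpen U) (hU' : U.Nonempty) :
    ∃ x ∈ U, ∀ i ∈ S, ∀ j ∈ S, i ≠ j →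
      (⟪a, dualVec (α i)⟫ - k i) * (⟪x, dualVec (α j)⟫ - k j) ≠
        (⟪a, dualVec (α j)⟫ - k j) * (⟪x, dualVec (α i)⟫ - k i) := by
  -- The forbidden equality for a pair q is the affine equation ⟪x, u q⟫ = c q; u q = 0 would make
  -- the two reflections equal.
  set u : ι × ι → V := fun q => (⟪a, dualVec (α q.1)⟫ - k q.1) • dualVec (α q.2) -
    (⟪a, dualVec (α q.2)⟫ - k q.2) • dualVec (α q.1) with hu
  set c : ι × ι → ℝ := fun q => (⟪a, dualVec (α q.1)⟫ - k q.1) * k q.2 -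
    (⟪a, dualVec (α q.2)⟫ - k q.2) * k q.1 with hc
  have hfin : ((fun q => {x : V | ⟪x, u q⟫ ≠ c q}) ''
      {q | (q.1 ∈ S ∧ q.2 ∈ S) ∧ q.1 ≠ q.2}).Finite :=
    ((hS.prod hS).subset fun q hq => hq.1).image _
  have hd := hfin.dense_sInter (by rintro _ ⟨q, -, rfl⟩; exact isOpen_inner_ne _ _) (by
    rintro _ ⟨q, ⟨⟨h1, h2⟩, h3⟩, rfl⟩
    refine dense_inner_ne (fun h => hne _ h1 _ h2 h3 ?_) _
    exact affineRefl_eq_of_smul_eq (ha _ h1) (ha _ h2) (sub_eq_zero.mp h))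
  obtain ⟨x, hxU, hx⟩ := hd.inter_open_nonempty U hU hU'
  refine ⟨x, hxU, fun i hi j hj hij h => ?_⟩
  have := Set.mem_sInter.mp hx _ ⟨(i, j), ⟨⟨hi, hj⟩, hij⟩, rfl⟩
  apply this
  simp only [hu, hc, inner_sub_right, inner_smul_right]
  linear_combination h

end Separation

/-! ### Inversion sets of the affine Weyl group and injectivity of ι -/

section Inversions

variable {I V N : Type*} [NormedAddCommGroup V] [InnerProductSpace ℝ V]
  [AddCommGroup N] [Module ℝ N] {P : RootPairing I ℝ V N}

/-- The affine reflections in the affine Weyl group. -/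
def reflections (P : RootPairing I ℝ V N) : Set (affineWeylGroup P) :=
  (↑) ⁻¹' {g | ∃ (i : I) (k : ℤ), g = affineRefl (P.root i) k}

/-- The reflections whose hyperplanes separate `a` from `w a`. -/
def inversions (a : V) (w : affineWeylGroup P) : Set (affineWeylGroup P) :=
  {t | t ∈ reflections P ∧ ⟪(t : V ≃ᵃ[ℝ] V) a - a,
    (t : V ≃ᵃ[ℝ] V) ((w : V ≃ᵃ[ℝ] V) a) - (w : V ≃ᵃ[ℝ] V) a⟫ < 0}

theorem closure_reflections : Subgroup.closure (reflections P) = ⊤ :=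
  Subgroup.closure_closure_coe_preimage

theorem mul_self_of_mem_reflections {t : affineWeylGroup P} (ht : t ∈ reflections P) :
    t * t = 1 := by
  obtain ⟨i, k, h⟩ := ht
  apply Subtype.ext
  rw [Subgroup.coe_mul, h]
  exact affineRefl_mul_self _ _

theorem finite_inversions [Finite I] (a : V) (w : affineWeylGroup P) :
    (inversions a w).Finite := by
  set c := (w : V ≃ᵃ[ℝ] V) a
  -- A separating hyperplane has its level between the two values of the coroot.
  have hfin : (⋃ i : I, (fun k : ℤ => affineReflMem P i k) ''
      Set.Icc ⌊min ⟪a, dualVec (P.root i)⟫ ⟪c, dualVec (P.root i)⟫⌋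
        ⌈max ⟪a, dualVec (P.root i)⟫ ⟪c, dualVec (P.root i)⟫⌉).Finite :=
    Set.finite_iUnion fun i => (Set.finite_Icc _ _).image _
  refine hfin.subset ?_
  rintro t ⟨⟨i, k, hik⟩, ht⟩
  rw [hik, inner_displacement_neg_iff (P.ne_zero i)] at ht
  refine Set.mem_iUnion.mpr ⟨i, k, ⟨?_, ?_⟩, Subtype.ext hik.symm⟩
  · have : min ⟪a, dualVec (P.root i)⟫ ⟪c, dualVec (P.root i)⟫ < k := by
      rw [min_lt_iff]
      by_contra! h
      nlinarith [mul_nonneg (sub_nonneg.mpr h.1) (sub_nonneg.mpr h.2)]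
    exact_mod_cast (Int.floor_le _).trans this.le
  · have : (k : ℝ) < max ⟪a, dualVec (P.root i)⟫ ⟪c, dualVec (P.root i)⟫ := by
      rw [lt_max_iff]
      by_contra! h
      nlinarith [mul_nonneg (sub_nonneg.mpr h.1) (sub_nonneg.mpr h.2)]
    exact_mod_cast this.le.trans (Int.le_ceil _)

theorem conj_mem_reflections [Finite I] [P.IsCrystallographic] (hP : IsEuclidean P)
    {t : affineWeylGroup P} (ht : t ∈ reflections P) (w : affineWeylGroup P) :
    w * t * w⁻¹ ∈ reflections P := by
  obtain ⟨i, k, h⟩ := ht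
  have hw := preservesRoots hP w.2
  obtain ⟨j, hj⟩ := hw.root i
  obtain ⟨n, hn⟩ := hw.int j
  refine ⟨j, k + n, ?_⟩
  ext x
  have h1 := apply_affineRefl hw.inner (P.root i) k (k + n)
    (by rw [← hj, hn]; push_cast; rfl) ((w : V ≃ᵃ[ℝ] V).symm x)
  rw [AffineEquiv.apply_symm_apply, ← h, ← hj] at h1
  exact h1

/-- Each coroot takes values strictly between consecutive integers on a strip intersection, so no
hyperplane meets it or separates two of its points. -/
theorem mul_pos_of_mem_stripInter [Finite I] [P.IsCrystallographic] {b : P.Base}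
    {k : PosRoot b → ℤ} {p q : V} (hp : p ∈ stripInter b k) (hq : q ∈ stripInter b k) (i : I)
    (m : ℤ) :
    0 < (⟪p, dualVec (P.root i)⟫ - m) * (⟪q, dualVec (P.root i)⟫ - m) := by
  revert m
  refine forall_of_posRoot b (p := fun i => ∀ m : ℤ,
    0 < (⟪p, dualVec (P.root i)⟫ - m) * (⟪q, dualVec (P.root i)⟫ - m)) (fun γ m => ?_)
    (fun j hj m => ?_) i
  · obtain ⟨h1, h2⟩ := Set.mem_iInter.mp hp γ
    obtain ⟨h3, h4⟩ := Set.mem_iInter.mp hq γ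
    rcases le_or_gt m (k γ) with h | h
    · have : (m : ℝ) ≤ k γ := by exact_mod_cast h
      exact mul_pos (by linarith) (by linarith)
    · have : (k γ : ℝ) + 1 ≤ m := by exact_mod_cast h
      exact mul_pos_of_neg_of_neg (by linarith) (by linarith)
  · have := hj (-m)
    rw [root_reflectionPerm_self, inner_dualVec_neg, inner_dualVec_neg]
    push_cast at this
    linarith

theorem isOpen_stripInter [Finite I] [P.IsCrystallographic] (b : P.Base) (k : PosRoot b → ℤ) :
    IsOpen (stripInter b k) := by
  refine isOpen_iInter_of_finite fun γ => ?_
  have h : strip (P.root γ) (k γ) 1 = {x | (k γ : ℝ) < ⟪x, dualVec (P.root γ)⟫} ∩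
    {x | ⟪x, dualVec (P.root γ)⟫ < k γ + 1} := rfl
  rw [h]
  exact (isOpen_lt continuous_const (by fun_prop)).inter (isOpen_lt (by fun_prop) continuous_const)

theorem xor_mul_neg {A B C : ℝ} (hA : A ≠ 0) (hB : B ≠ 0) (hC : C ≠ 0) :
    A * C < 0 ↔ Xor (A * B < 0) (B * C < 0) := by
  rw [xor_def]
  rcases lt_or_gt_of_ne hA with hA | hA <;> rcases lt_or_gt_of_ne hB with hB | hB <;>
    rcases lt_or_gt_of_ne hC with hC | hC <;>
    simp [mul_neg_iff, hA, hB, hC, hA.not_gt, hB.not_gt, hC.not_gt]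

variable [Finite I] [P.IsCrystallographic] [FiniteDimensional ℝ V]

/-- The hyperplane first crossed on the way from `a` to `w a` is a wall of the alcove of `a`. -/
theorem exists_simple_inversion (hP : IsEuclidean P) {b : P.Base} {a : V}
    (ha : a ∈ stripInter b (fun _ => 0)) (w : affineWeylGroup P) (hw : (inversions a w).Nonempty) :
    ∃ s ∈ inversions a w, inversions a s = {s} := by
  have hrep : ∀ t : affineWeylGroup P, ∃ (i : I) (k : ℤ), t ∈ reflections P →
      (t : V ≃ᵃ[ℝ] V) = affineRefl (P.root i) k := by
    intro t
    by_cases ht : t ∈ reflections P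
    · obtain ⟨i, k, h⟩ := ht
      exact ⟨i, k, fun _ => h⟩
    · obtain ⟨_, ⟨i, k, -⟩, -⟩ := hw
      exact ⟨i, k, fun h => absurd h ht⟩
  choose idx lev hrep using hrep
  set f : affineWeylGroup P → V → ℝ := fun t x => ⟪x, dualVec (P.root (idx t))⟫ - lev t with hf
  have hfa : ∀ t, f t a ≠ 0 := fun t h => by
    have := mul_pos_of_mem_stripInter ha ha (idx t) (lev t)
    exact this.ne' (by simp only [hf] at h; rw [h, zero_mul])
  have hsep : ∀ t ∈ reflections P, ∀ x y,
      ⟪(t : V ≃ᵃ[ℝ] V) x - x, (t : V ≃ᵃ[ℝ] V) y - y⟫ < 0 ↔ f t x * f t y < 0 := by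
    intro t ht x y
    rw [hrep t ht, inner_displacement_neg_iff (P.ne_zero _)]
  have hwsep : ∀ t ∈ reflections P, ∀ x y,
      ⟪(t : V ≃ᵃ[ℝ] V) x - x, (t : V ≃ᵃ[ℝ] V) y - y⟫ ≤ 0 ↔ f t x * f t y ≤ 0 := by
    intro t ht x y
    rw [hrep t ht, inner_displacement_nonpos_iff (P.ne_zero _)]
  -- Replacing w a by a generic `c` in the same alcove keeps the inversions and makes the crossing
  -- times distinct.
  obtain ⟨c, hcU, hc⟩ := exists_generic (finite_inversions a w) (fun t => P.root (idx t)) lev a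
    (fun t _ => hfa t) (fun s hs t ht hst h => hst (Subtype.ext (by
      rw [hrep s hs.1, hrep t ht.1, h])))
    (isOpen_stripInter b (shiCoeff b w))
    (alcove_eq_stripInter_shiCoeff hP b w ▸ alcove_nonempty b w)
  have hwa : (w : V ≃ᵃ[ℝ] V) a ∈ stripInter b (shiCoeff b w) :=
    alcove_eq_stripInter_shiCoeff hP b w ▸ Set.mem_image_of_mem _ ha
  have hmem : ∀ t, t ∈ inversions a w ↔ t ∈ reflections P ∧ f t a * f t c < 0 := by
    intro t
    refine and_congr_right fun ht => ?_
    rw [hsep t ht]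
    have h1 : 0 < f t ((w : V ≃ᵃ[ℝ] V) a) * f t c :=
      mul_pos_of_mem_stripInter hwa hcU (idx t) (lev t)
    have h2 : 0 < f t a * f t a := mul_self_pos.mpr (hfa t)
    constructor <;> intro h <;> nlinarith [mul_pos h1 h2]
  -- The zero of `f t` on the segment from a to c, at time f a / (f a - f c), expanded by `f t a` so
  -- that numerator and denominator are positive for inversions.
  set τ : affineWeylGroup P → ℝ := fun t => f t a ^ 2 / (f t a ^ 2 - f t a * f t c) with hτ
  obtain ⟨s, hs, hmin⟩ := Set.exists_min_image (inversions a w) τ (finite_inversions a w) hw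
  have hsT := hs.1
  have hs' := ((hmem s).mp hs).2
  have hsa : 0 < f s a ^ 2 := by have := hfa s; positivity
  have hτ0 : 0 < τ s := div_pos hsa (by linarith)
  have hτ1 : τ s < 1 := (div_lt_one (by linarith)).mpr (by linarith)
  set m : V := a + τ s • (c - a) with hm
  have hfm : ∀ t, f t m = (1 - τ s) * f t a + τ s * f t c := by
    intro t
    simp only [hf, hm, inner_add_left, inner_smul_left, inner_sub_left, RCLike.conj_to_real]
    ring
  have hsm : f s m = 0 := by
    rw [hfm]
    have h : τ s * (f s a ^ 2 - f s a * f s c) = f s a ^ 2 := div_mul_cancel₀ _ (by linarith)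
    apply mul_left_cancel₀ (hfa s)
    linear_combination -h
  have hfix : (s : V ≃ᵃ[ℝ] V) m = m := by
    rw [hrep s hsT, affineRefl_apply]
    simp only [hf] at hsm
    rw [hsm, zero_smul, sub_zero]
  -- A hyperplane that contains m or separates a from m is crossed no later than that of s, so
  -- minimality and genericity identify them.
  have hfirst : ∀ r ∈ reflections P,
      ⟪(r : V ≃ᵃ[ℝ] V) a - a, (r : V ≃ᵃ[ℝ] V) m - m⟫ ≤ 0 → r = s := by
    intro r hr h
    rw [hwsep r hr, hfm] at h
    have hra : 0 < f r a ^ 2 := by have := hfa r; positivity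
    have hrc : f r a * f r c < 0 := by
      by_contra! h'
      nlinarith [mul_pos (sub_pos.mpr hτ1) hra, mul_nonneg hτ0.le h']
    have hrw : r ∈ inversions a w := (hmem r).mpr ⟨hr, hrc⟩
    have hle : τ r ≤ τ s := by
      simp only [hτ] at h ⊢
      rw [div_le_iff₀ (by linarith)]
      linarith
    have heq : τ r = τ s := le_antisymm hle (hmin r hrw)
    by_contra hrs
    refine hc r hrw s hs hrs ?_
    change f r a * f s c = f s a * f r c
    simp only [hτ] at heq
    rw [div_eq_div_iff (by linarith) (by linarith)] at heq
    have h1 := hfa r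
    have h2 := hfa s
    apply mul_left_cancel₀ (mul_ne_zero h1 h2)
    linear_combination -heq
  refine ⟨s, hs, Set.eq_singleton_iff_unique_mem.mpr ⟨⟨hsT, ?_⟩, fun r ⟨hr, hrs⟩ => ?_⟩⟩
  · rw [hrep s hsT]
    exact inner_displacement_apply_neg (hfa s) (P.ne_zero _)
  · by_cases h : ⟪(r : V ≃ᵃ[ℝ] V) a - a, (r : V ≃ᵃ[ℝ] V) m - m⟫ ≤ 0
    · exact hfirst r hr h
    · rw [hwsep r hr, not_le] at h
      rw [hsep r hr] at hrs
      -- Here a and m lie strictly on one side of r, so r weakly separates s a from m = s m.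
      -- Conjugating by s, s⁻¹ r s weakly separates a from m, hence equals s.
      have h1 : f r ((s : V ≃ᵃ[ℝ] V) a) * f r m ≤ 0 := by
        by_contra! h'
        nlinarith [mul_pos h h', mul_self_nonneg (f r m)]
      rw [← hwsep r hr] at h1
      have h2 := inner_displacement_conj (preservesRoots hP (s⁻¹).2).inner (r : V ≃ᵃ[ℝ] V)
        ((s : V ≃ᵃ[ℝ] V) a) m
      have h3 : ((s⁻¹ : affineWeylGroup P) : V ≃ᵃ[ℝ] V) ((s : V ≃ᵃ[ℝ] V) a) = a :=
        (s : V ≃ᵃ[ℝ] V).symm_apply_apply a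
      have h4 : ((s⁻¹ : affineWeylGroup P) : V ≃ᵃ[ℝ] V) m = m := by
        conv_lhs => rw [← hfix]
        exact (s : V ≃ᵃ[ℝ] V).symm_apply_apply m
      rw [h3, h4] at h2
      have h5 := hfirst (s⁻¹ * r * s⁻¹⁻¹) (conj_mem_reflections hP hr _) (h2.trans_le h1)
      rw [inv_inv, mul_assoc, inv_mul_eq_iff_eq_mul] at h5
      exact mul_right_cancel h5

theorem isInversionCocycle (hP : IsEuclidean P) {b : P.Base} {a : V}
    (ha : a ∈ stripInter b (fun _ => 0)) : IsInversionCocycle (reflections P) (inversions a) where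
  closure_eq := closure_reflections
  mul_self _ := mul_self_of_mem_reflections
  conj_mem _ ht x := conj_mem_reflections hP ht x
  subset _ _ ht := ht.1
  finite := finite_inversions a
  cocycle x y t ht := by
    have hpt : ∀ z : affineWeylGroup P, ∀ (i : I) (k : ℤ),
        ⟪(z : V ≃ᵃ[ℝ] V) a, dualVec (P.root i)⟫ - k ≠ 0 := by
      intro z i k h
      have hz : (z : V ≃ᵃ[ℝ] V) a ∈ stripInter b (shiCoeff b z) :=
        alcove_eq_stripInter_shiCoeff hP b z ▸ Set.mem_image_of_mem _ ha
      exact (mul_pos_of_mem_stripInter hz hz i k).ne' (by rw [h, zero_mul])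
    have h1 := inner_displacement_conj (preservesRoots hP (x⁻¹).2).inner (t : V ≃ᵃ[ℝ] V)
      ((x : V ≃ᵃ[ℝ] V) a) ((x : V ≃ᵃ[ℝ] V) ((y : V ≃ᵃ[ℝ] V) a))
    have h2 : ∀ u, ((x⁻¹ : affineWeylGroup P) : V ≃ᵃ[ℝ] V) ((x : V ≃ᵃ[ℝ] V) u) = u :=
      (x : V ≃ᵃ[ℝ] V).symm_apply_apply
    rw [h2, h2] at h1
    have h3 : x⁻¹ * t * x ∈ reflections P := by
      simpa using conj_mem_reflections hP ht x⁻¹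
    have h4 : x⁻¹ * t * x ∈ inversions a y ↔ ⟪(t : V ≃ᵃ[ℝ] V) ((x : V ≃ᵃ[ℝ] V) a) -
        (x : V ≃ᵃ[ℝ] V) a, (t : V ≃ᵃ[ℝ] V) ((x : V ≃ᵃ[ℝ] V) ((y : V ≃ᵃ[ℝ] V) a)) -
          (x : V ≃ᵃ[ℝ] V) ((y : V ≃ᵃ[ℝ] V) a)⟫ < 0 := by
      rw [← h1]
      exact and_iff_right h3
    rw [h4]
    obtain ⟨i, k, hik⟩ := id ht
    have h5 : ∀ z, t ∈ inversions a z ↔ (⟪a, dualVec (P.root i)⟫ - k) *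
        (⟪(z : V ≃ᵃ[ℝ] V) a, dualVec (P.root i)⟫ - k) < 0 := by
      intro z
      rw [← inner_displacement_neg_iff (P.ne_zero i), ← hik]
      exact and_iff_right ht
    rw [h5, h5, hik, inner_displacement_neg_iff (P.ne_zero i)]
    exact xor_mul_neg (hpt 1 i k) (hpt x i k) (hpt (x * y) i k)
  self_mem t ht := by
    refine ⟨ht, ?_⟩
    obtain ⟨i, k, hik⟩ := ht
    rw [hik]
    refine inner_displacement_apply_neg (fun h => ?_) (P.ne_zero i)
    exact (mul_pos_of_mem_stripInter ha ha i k).ne' (by rw [h, zero_mul])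
  exists_simple w hw := exists_simple_inversion hP ha w hw

/-- Equal tuples give equal alcoves, so w'⁻¹ w keeps a inside A_e and has no inversions. -/
theorem iota_injective (hP : IsEuclidean P) (b : P.Base) : Function.Injective (iota b) := by
  intro w w' h
  obtain ⟨a, ha⟩ := stripInter_zero_nonempty b
  have hk : shiCoeff b w = shiCoeff b w' := by
    funext γ
    have := congrFun (congrArg WithLp.ofLp h) γ
    exact Int.cast_injective (α := ℝ) this
  have halc : alcove b w = alcove b w' := by
    rw [alcove_eq_stripInter_shiCoeff hP, alcove_eq_stripInter_shiCoeff hP, hk]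
  have hmem : ((w'⁻¹ * w : affineWeylGroup P) : V ≃ᵃ[ℝ] V) a ∈ stripInter b (fun _ => 0) := by
    have h1 : (w : V ≃ᵃ[ℝ] V) a ∈ alcove b w' := halc ▸ Set.mem_image_of_mem _ ha
    obtain ⟨c, hc, hc'⟩ := h1
    have : ((w'⁻¹ * w : affineWeylGroup P) : V ≃ᵃ[ℝ] V) a = c := by
      change (w' : V ≃ᵃ[ℝ] V).symm ((w : V ≃ᵃ[ℝ] V) a) = c
      rw [← hc', AffineEquiv.symm_apply_apply]
    rwa [this]
  have hempty : inversions a (w'⁻¹ * w) = ∅ := by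
    refine Set.eq_empty_of_forall_notMem fun t ht => ?_
    obtain ⟨⟨i, k, hik⟩, ht⟩ := ht
    rw [hik, inner_displacement_neg_iff (P.ne_zero i)] at ht
    exact ht.not_gt (mul_pos_of_mem_stripInter ha hmem i k)
  have := (isInversionCocycle hP ha).eq_one_of_eq_empty _ hempty
  exact (inv_mul_eq_one.mp this).symm

theorem phiRep_injective (hP : IsEuclidean P) (b : P.Base) :
    Function.Injective (phiRep hP b) := by
  intro w w' h
  have h1 := congrFun (phiRep_comp_iota hP b w) 1
  have h2 := congrFun (phiRep_comp_iota hP b w') 1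
  simp only [Function.comp_apply, mul_one] at h1 h2
  exact iota_injective hP b (by rw [← h1, ← h2, h])

end Inversions

/-! ### The matrix and translation of an affine reflection -/

section SignedPermutation

variable {I V N : Type*} [NormedAddCommGroup V] [InnerProductSpace ℝ V]
  [AddCommGroup N] [Module ℝ N] {P : RootPairing I ℝ V N}

open Classical in
/-- The positive root among `s_α(γ)` and `-s_α(γ)`. -/
def absReflFun (b : P.Base) (α γ : PosRoot b) : PosRoot b :=
  if h : b.IsPos (P.reflectionPerm α γ) then ⟨_, h⟩
  else ⟨P.reflectionPerm (P.reflectionPerm α γ) (P.reflectionPerm α γ), (isPos_neg_iff b _).mpr h⟩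

theorem reflectionPerm_neg (i j : I) :
    P.reflectionPerm i (P.reflectionPerm j j) =
      P.reflectionPerm (P.reflectionPerm i j) (P.reflectionPerm i j) := by
  apply P.root.injective
  rw [root_reflectionPerm_self, P.root_reflectionPerm, root_reflectionPerm_self,
    P.root_reflectionPerm, map_neg]

theorem absReflFun_involutive (b : P.Base) (α : PosRoot b) :
    Function.Involutive (absReflFun b α) := by
  intro γ
  apply Subtype.ext
  by_cases h : b.IsPos (P.reflectionPerm α γ)
  · have h1 : absReflFun b α γ = ⟨_, h⟩ := dif_pos h
    have h2 : b.IsPos (P.reflectionPerm α (P.reflectionPerm α γ)) := by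
      rw [P.reflectionPerm_self]
      exact γ.2
    rw [h1, absReflFun, dif_pos h2]
    exact P.reflectionPerm_self _ _
  · have h1 : absReflFun b α γ = ⟨_, (isPos_neg_iff b _).mpr h⟩ := dif_neg h
    have h2 : ¬ b.IsPos (P.reflectionPerm α
        (P.reflectionPerm (P.reflectionPerm α γ) (P.reflectionPerm α γ))) := by
      rw [reflectionPerm_neg, P.reflectionPerm_self, isPos_neg_iff, not_not]
      exact γ.2
    rw [h1, absReflFun, dif_neg h2]
    change P.reflectionPerm (P.reflectionPerm _ (P.reflectionPerm _ _)) _ = _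
    rw [reflectionPerm_neg, P.reflectionPerm_self, reflectionPerm_self_self]

open Classical in
/-- The sign `ε` with `ε s_α(γ)` positive. -/
def reflSign (b : P.Base) (α γ : PosRoot b) : ℤˣ :=
  if b.IsPos (P.reflectionPerm α γ) then 1 else -1

theorem oddExt_reflectionPerm (b : P.Base) (α γ : PosRoot b) (y : PosRoot b → ℝ) :
    oddExt b y (P.reflectionPerm α γ) =
      ((reflSign b α γ : ℤ) : ℝ) * (y (absReflFun b α γ) + 1 / 2) := by
  by_cases h : b.IsPos (P.reflectionPerm α γ)
  · rw [oddExt, reflSign, absReflFun, dif_pos h, if_pos h, dif_pos h]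
    simp
  · rw [oddExt, reflSign, absReflFun, dif_neg h, if_neg h, dif_neg h]
    simp

theorem IsEuclidean.refl_root (hP : IsEuclidean P) (i j : I) :
    refl (P.root i) (P.root j) = P.root (P.reflectionPerm i j) := by
  rw [P.root_reflectionPerm, hP]

theorem IsEuclidean.refl_root_eq_iff (hP : IsEuclidean P) {b : P.Base} {α γ δ : PosRoot b} :
    refl (P.root α) (P.root γ) = P.root δ ↔ P.reflectionPerm α γ = δ := by
  rw [hP.refl_root, P.root.injective.eq_iff]

theorem IsEuclidean.refl_root_eq_neg_iff (hP : IsEuclidean P) {b : P.Base} {α γ δ : PosRoot b} :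
    refl (P.root α) (P.root γ) = -P.root δ ↔
      P.reflectionPerm (P.reflectionPerm α γ) (P.reflectionPerm α γ) = δ := by
  rw [hP.refl_root, ← P.root.injective.eq_iff, root_reflectionPerm_self, neg_eq_iff_eq_neg]

open Classical in
theorem Lmat_apply (hP : IsEuclidean P) (b : P.Base) (α γ δ : PosRoot b) :
    Lmat b α δ γ = if absReflFun b α γ = δ then ((reflSign b α γ : ℤ) : ℝ) else 0 := by
  simp only [Lmat, Matrix.of_apply, Subtype.ext_iff, hP.refl_root_eq_iff, hP.refl_root_eq_neg_iff]
  by_cases h : b.IsPos (P.reflectionPerm α γ)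
  · have h2 : P.reflectionPerm (P.reflectionPerm α γ) (P.reflectionPerm α γ) ≠ δ := fun h' =>
      (isPos_neg_iff b _).mp (h' ▸ δ.2) h
    simp only [reflSign, absReflFun, if_pos h, dif_pos h, if_neg h2, Units.val_one, Int.cast_one]
  · have h2 : P.reflectionPerm α γ ≠ δ := fun h' => h (h' ▸ δ.2)
    simp only [reflSign, absReflFun, if_neg h, dif_neg h, if_neg h2, Units.val_neg, Units.val_one,
      Int.cast_neg, Int.cast_one]

theorem isSignedPerm_Lmat (hP : IsEuclidean P) (b : P.Base) (α : PosRoot b) :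
    IsSignedPerm (Lmat b α) :=
  ⟨(absReflFun_involutive b α).toPerm, reflSign b α, fun δ γ => by
    rw [Lmat_apply hP]
    congr⟩

/-- As s_α is an involution, the column description `Lmat_apply` also describes the rows, which
`mulVec` sums over. -/
theorem Lmat_symm (b : P.Base) (α γ δ : PosRoot b) : Lmat b α γ δ = Lmat b α δ γ := by
  have h1 : refl (P.root α) (P.root δ) = P.root γ ↔ refl (P.root α) (P.root γ) = P.root δ := by
    constructor <;> intro h <;> rw [← h, refl_involutive]
  have h2 : refl (P.root α) (P.root δ) = -P.root γ ↔ refl (P.root α) (P.root γ) = -P.root δ := by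
    constructor <;> intro h <;> rw [← neg_eq_iff_eq_neg] at h <;>
      rw [← h, map_neg, refl_involutive]
  classical exact if_congr h1 rfl (if_congr h2 rfl rfl)

variable [Finite I]

theorem Lmat_mulVec (hP : IsEuclidean P) (b : P.Base) (α γ : PosRoot b) (y : PosRoot b → ℝ) :
    (Lmat b α).mulVec y γ = ((reflSign b α γ : ℤ) : ℝ) * y (absReflFun b α γ) := by
  classical
  simp only [Matrix.mulVec, dotProduct, Lmat_symm b α γ, Lmat_apply hP, ite_mul, zero_mul]
  rw [Finset.sum_ite_eq Finset.univ, if_pos (Finset.mem_univ _)]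

theorem phiAct_affineReflMem [P.IsCrystallographic] (hP : IsEuclidean P) (b : P.Base) (α : PosRoot b) (p : ℤ)
    (y : PosRoot b → ℝ) (γ : PosRoot b) :
    phiAct hP b (affineReflMem P α p) y γ =
      (Lmat b α).mulVec y γ + vvec b p α γ := by
  have h1 : rootIdx hP (affineReflMem P α p)⁻¹ γ = P.reflectionPerm α γ := by
    apply P.root.injective
    rw [root_rootIdx, Subgroup.coe_inv]
    change (affineRefl (P.root α) p)⁻¹.linear _ = _
    rw [affineRefl_inv, affineRefl_linear, hP.refl_root]
  have h2 : ((affineReflMem P α p : affineWeylGroup P) : V ≃ᵃ[ℝ] V) 0 = (p : ℝ) • P.root α := by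
    change affineRefl (P.root α) p 0 = _
    simp [affineRefl_apply]
  -- s_α is isometric and negates α; this explains the sign of p in `vvec`.
  have h3 : ⟪P.root α, dualVec (refl (P.root α) (P.root γ))⟫ =
      -⟪P.root α, dualVec (P.root γ)⟫ := by
    have h := inner_dualVec_map (inner_refl_refl (P.root α)) (P.root α) (P.root γ)
    rw [refl_self, inner_neg_left] at h
    linarith
  have h4 : (∃ δ : PosRoot b, refl (P.root α) (P.root γ) = P.root δ) ↔
      b.IsPos (P.reflectionPerm α γ) := by
    simp only [hP.refl_root_eq_iff]
    exact ⟨fun ⟨δ, hδ⟩ => hδ ▸ δ.2, fun h => ⟨⟨_, h⟩, rfl⟩⟩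
  rw [phiAct, h1, h2, oddExt_reflectionPerm, Lmat_mulVec hP, inner_smul_left,
    RCLike.conj_to_real, vvec]
  simp only [h3]
  by_cases h : b.IsPos (P.reflectionPerm α γ)
  · rw [reflSign, if_pos h, if_pos (h4.mpr h)]
    simp only [Units.val_one, Int.cast_one]
    ring
  -- The half-shifts add up instead of cancelling: -(y + 1/2) - 1/2 = -y - 1.
  · rw [reflSign, if_neg h, if_neg (mt h4.mp h)]
    simp only [Units.val_neg, Units.val_one, Int.cast_neg, Int.cast_one]
    ring

end SignedPermutation

end PhiRep

end

theorem theorem3p1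
    {I V N : Type*} [Finite I]
    [NormedAddCommGroup V] [InnerProductSpace ℝ V] [FiniteDimensional ℝ V]
    [AddCommGroup N] [Module ℝ N]
    (P : RootPairing I ℝ V N) [P.IsRootSystem] [P.IsCrystallographic] [P.IsReduced]
    [P.IsIrreducible]
    (hP : ∀ (i : I) (x : V), P.reflection i x = PhiRep.refl (P.root i) x)
    (b : P.Base) :
    (∀ (w : PhiRep.affineWeylGroup P) (k : PhiRep.PosRoot b → ℤ),
      PhiRep.alcove b w = PhiRep.stripInter b k ↔ k = PhiRep.shiCoeff b w) ∧
    Function.Injective (PhiRep.iota b) ∧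
    ∃ F : PhiRep.affineWeylGroup P →* (PhiRep.PhiSpace b ≃ᵃⁱ[ℝ] PhiRep.PhiSpace b),
      Function.Injective F ∧
      (∀ w : PhiRep.affineWeylGroup P,
        F w ∘ PhiRep.iota b = PhiRep.iota b ∘ fun x => w * x) ∧
      ∀ (α : PhiRep.PosRoot b) (p : ℤ),
        PhiRep.IsSignedPerm (PhiRep.Lmat b α) ∧
        ∀ x : PhiRep.PhiSpace b,
          F (PhiRep.affineReflMem P α p) x =
            WithLp.toLp 2 ((PhiRep.Lmat b α).mulVec (WithLp.ofLp x)) + PhiRep.vvec b p α := by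
  refine ⟨PhiRep.alcove_eq_stripInter_iff hP b, PhiRep.iota_injective hP b, PhiRep.phiRep hP b,
    PhiRep.phiRep_injective hP b, PhiRep.phiRep_comp_iota hP b, fun α p =>
      ⟨PhiRep.isSignedPerm_Lmat hP b α, fun x => ?_⟩⟩
  ext γ
  exact PhiRep.phiAct_affineReflMem hP b α p (WithLp.ofLp x) γ
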